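/- Let $G$ be a graph. A rooted tree $T\subseteq G$ is normal in $G$ if the endvertices of every path in $G$ that meets $T$ exactly in its endvertices are comparable in the tree-order of $T$. A set $U\subseteq V(G)$ is normally spanned in $G$ if $U\subseteq V(T)$ for some normal tree $T\subseteq G$. A normal spanning tree of $G$ is a normal tree containing all vertices of $G$. For a family $\mathcal I$ of vertex sets, a graph $H$ has $\mathcal I$-rank $0$ if $V(H)\in\mathcal I$; and for an ordinal $\alpha>0$, $H$ has $\mathcal I$-rank $\alpha$ if it has no $\mathcal I$-rank less than $\alpha$ and there is a set $X\subseteq V(H)$ with $X\in\mathcal I$ such that every component of $H-X$ has some $\mathcal I$-rank less than $\alpha$. The $\aleph_1$-rank is the $\mathcal I$-rank for the family $\mathcal I$ of all sets of size less than $\aleph_1$. The normal rank of a connected graph $G$ is its $\mathcal I$-rank for the family $\mathcal I$ of all vertex sets that are normally spanned in $G$. An $\aleph_1$-branching tree with all tops is a graph obtained from the rooted tree $T_{\aleph_1}$ in which every vertex has exactly $\aleph_1$ children by adding, for every ray $R$ starting at the root, a new vertex (the top of $R$) and joining it to infinitely many vertices of $R$ (and to no other vertices). **Lemma 4.1.**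 (i) If a connected graph $G$ has $\aleph_1$-rank $\alpha$, then $G$ has a normal rank, and its normal rank is at most $\alpha$. (ii) There are connected graphs that have a normal rank but that have neither an $\aleph_1$-rank nor a normal spanning tree. For instance, every $\aleph_1$-branching tree with all tops is such a graph. -/

import Mathlib

universe u v

namespace NormalRank

section Rank

variable {V : Type u} {G : SimpleGraph V}

/-- `C` is a component of the subgraph `H` of `G`: a maximal connected (in particular nonempty)
subgraph of `H`. -/
def IsComponent (C H : G.Subgraph) : Prop :=
  Maximal (fun K : G.Subgraph => K ≤ H ∧ K.Connected) C

/-- The subgraph `H` of `G` has `I`-rank `α`, where `I` is a family of sets of vertices of `G`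
(in the applications an ideal). Rank `0` means that the vertex set of `H` lies in `I`. For `α > 0`,
`H` has rank `α` if it has no rank less than `α` and there is a set `X ∈ I` of vertices of `H` such
that every component of `H - X` has some rank less than `α`. -/
def HasIdealRank (I : Set (Set V)) (α : Ordinal.{v}) (H : G.Subgraph) : Prop :=
  (α = 0 ∧ H.verts ∈ I) ∨
    (0 < α ∧ (∀ β : Ordinal.{v}, ∀ _ : β < α, ¬ HasIdealRank I β H) ∧
      ∃ X ∈ I, X ⊆ H.verts ∧ ∀ C : G.Subgraph, IsComponent C (H.deleteVerts X) →
        ∃ β : Ordinal.{v}, ∃ _ : β < α, HasIdealRank I β C)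
termination_by α

/-- The graph `G` has `κ`-rank `α`: the rank with respect to the ideal of all sets of size
less than `κ`. -/
def HasCardRank (G : SimpleGraph V) (κ : Cardinal.{u}) (α : Ordinal.{v}) : Prop :=
  HasIdealRank {X : Set V | Cardinal.mk X < κ} α (⊤ : G.Subgraph)

/-- The tree-order of the tree `T` with root `r`: `x ≤ y` if `x` lies on the path in `T`
from `r` to `y`. -/
def TreeLE (T : G.Subgraph) (r x y : V) : Prop :=
  ∃ p : T.spanningCoe.Walk r y, p.IsPath ∧ x ∈ p.support

/-- `T ⊆ G` is a tree which, rooted at its vertex `r`, is normal in `G`: the endvertices of every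
path in `G` that meets `T` exactly in its endvertices are comparable in the tree-order. -/
structure IsNormalTree (T : G.Subgraph) (r : V) : Prop where
  root_mem : r ∈ T.verts
  isTree : T.coe.IsTree
  comparable : ∀ x ∈ T.verts, ∀ y ∈ T.verts, ∀ p : G.Walk x y, p.IsPath →
    (∀ z ∈ p.support, z ∈ T.verts → z = x ∨ z = y) → TreeLE T r x y ∨ TreeLE T r y x

/-- The set `U` of vertices is normally spanned in `G`: it is contained in a normal tree. -/
def NormallySpanned (G : SimpleGraph V) (U : Set V) : Prop :=
  ∃ (T : G.Subgraph) (r : V), IsNormalTree T r ∧ U ⊆ T.verts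

/-- `G` has a normal spanning tree. -/
def HasNormalSpanningTree (G : SimpleGraph V) : Prop :=
  ∃ (T : G.Subgraph) (r : V), IsNormalTree T r ∧ T.IsSpanning

/-- The subgraph `H` of the graph `G` has normal rank `α` in `G`: the rank with respect to the
family of the vertex sets that are normally spanned in `G`. -/
def HasNormalRankIn (G : SimpleGraph V) (α : Ordinal.{v}) (H : G.Subgraph) : Prop :=
  HasIdealRank {X : Set V | NormallySpanned G X} α H

/-- The graph `G` has normal rank `α`, that is, it has normal rank `α` in itself. (Used for
connected graphs only.) -/
def HasNormalRank (G : SimpleGraph V) (α : Ordinal.{v}) : Prop :=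
  HasNormalRankIn G α ⊤

end Rank

section Tops

variable {ι : Type u}

/-- The `n`-th vertex (counting from `0`, the root) of the rooted ray that is given by the
sequence `f`, in the tree of finite sequences. -/
def rayVertex (f : ℕ → ι) (n : ℕ) : List ι := (List.range n).map f

/-- The relation generating the edges of a tree of finite sequences with all tops. The vertices
`Sum.inl s` for finite sequences `s` in `ι` are the nodes of the rooted tree in which the children
of `s` are the sequences `s ++ [i]`, so that every node has `#ι` children; the root is `[]`.
The rooted rays of this tree correspond to the infinite sequences `f : ℕ → ι`, and `Sum.inr f` is
the top of the ray given by `f`; it is joined to the `n`-th vertices of this ray for `n ∈ N f`. -/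
def topsRel (N : (ℕ → ι) → Set ℕ) : List ι ⊕ (ℕ → ι) → List ι ⊕ (ℕ → ι) → Prop
  | Sum.inl s, Sum.inl t => ∃ i : ι, t = s ++ [i]
  | Sum.inr f, Sum.inl s => ∃ n ∈ N f, s = rayVertex f n
  | _, _ => False

/-- The `#ι`-branching tree with all tops, where `N f` is the set of heights at which the top of
the rooted ray given by `f` is joined to this ray. -/
def treeWithAllTops (N : (ℕ → ι) → Set ℕ) : SimpleGraph (List ι ⊕ (ℕ → ι)) :=
  SimpleGraph.fromRel (topsRel N)

end Tops

end NormalRank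

/-! For (i), enlarging the family of sets never raises ranks, so it suffices that countable sets are
normally spanned (Jung's theorem, `normallySpanned_of_countable`). Finite normal trees are extended
one prescribed vertex `v` at a time: by normality the neighbours in the tree of the component
containing `v` form a finite chain, and attaching a path to `v` at their maximum keeps the tree
normal. The union of the resulting sequence is normal.

For (ii), the underlying tree is normal, since the neighbours of each top lie on one ray; deleting
it leaves isolated tops, so the normal rank is at most 1. A countable set misses the whole cone
above some child of any given node, so by induction no graph containing a cone has an `ℵ₁`-rank. In
a normal spanning tree every cone would have a least vertex. Descending through cones that each
avoid the least vertex of the previous one yields a ray whose top has infinitely many vertices below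
it in the tree-order, which is absurd. -/

namespace NormalRank

open SimpleGraph

/-! ### Subgraph trees and the tree-order -/

section Trees

variable {V : Type u} {G : SimpleGraph V} {T T' : G.Subgraph} {r x y z c : V}

lemma eq_of_isPath (hac : G.IsAcyclic) {p q : G.Walk x y} (hp : p.IsPath) (hq : q.IsPath) :
    p = q :=
  congrArg Subtype.val ((hac.subsingleton_path x y).elim ⟨p, hp⟩ ⟨q, hq⟩)

lemma mem_verts_of_mem_support_spanningCoe (p : T.spanningCoe.Walk x y) (hx : x ∈ T.verts) :
    ∀ z ∈ p.support, z ∈ T.verts := by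
  induction p with
  | nil => simpa using hx
  | cons h p ih =>
    intro z hz
    rw [Walk.support_cons, List.mem_cons] at hz
    rcases hz with rfl | hz
    · exact hx
    · exact ih (T.edge_vert (T.adj_symm h)) z hz

lemma coe_eq_induce_spanningCoe (T : G.Subgraph) : T.coe = T.spanningCoe.induce T.verts := by
  ext a b
  simp

/-- A cycle starts with an edge, hence in `T`, and stays there. This lets all walks live in `V`. -/
lemma coe_isAcyclic_iff : T.coe.IsAcyclic ↔ T.spanningCoe.IsAcyclic := by
  refine ⟨fun h a w hw => ?_, fun h => h.embedding T.coeEmbeddingSpanningCoe⟩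
  have ha : a ∈ T.verts := by
    cases w with
    | nil => exact absurd rfl hw.ne_nil
    | cons h p => exact T.edge_vert h
  rw [coe_eq_induce_spanningCoe] at h
  refine h (w.induce T.verts (mem_verts_of_mem_support_spanningCoe w ha)) ?_
  rw [← Walk.isCycle_map_iff_of_injective (f := (Embedding.induce T.verts).toHom)
    (Embedding.induce (G := T.spanningCoe) T.verts).injective, Walk.map_induce]
  exact hw

lemma reachable_spanningCoe (h : T.coe.Connected) (hx : x ∈ T.verts) (hy : y ∈ T.verts) :
    T.spanningCoe.Reachable x y :=
  (h.preconnected ⟨x, hx⟩ ⟨y, hy⟩).map T.coeEmbeddingSpanningCoe.toHom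

lemma coe_isTree_of_reachable (hr : r ∈ T.verts) (hac : T.spanningCoe.IsAcyclic)
    (h : ∀ x ∈ T.verts, T.spanningCoe.Reachable r x) : T.coe.IsTree := by
  refine ⟨?_, coe_isAcyclic_iff.2 hac⟩
  rw [connected_iff_exists_forall_reachable]
  refine ⟨⟨r, hr⟩, fun ⟨x, hx⟩ => ?_⟩
  obtain ⟨p⟩ := h x hx
  rw [coe_eq_induce_spanningCoe]
  exact ⟨p.induce T.verts (mem_verts_of_mem_support_spanningCoe p hr)⟩

lemma TreeLE.mono (hTT' : T ≤ T') (h : TreeLE T r x y) : TreeLE T' r x y := by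
  obtain ⟨p, hp, hx⟩ := h
  refine ⟨p.mapLe (Subgraph.spanningCoe_le_of_le hTT'), Walk.isPath_mapLe _ |>.2 hp, ?_⟩
  rwa [Walk.support_mapLe_eq_support]

lemma TreeLE.refl (h : T.coe.Connected) (hr : r ∈ T.verts) (hx : x ∈ T.verts) :
    TreeLE T r x x := by
  classical
  obtain ⟨p⟩ := reachable_spanningCoe h hr hx
  exact ⟨p.bypass, p.bypass_isPath, Walk.end_mem_support _⟩

lemma TreeLE.trans (hac : T.spanningCoe.IsAcyclic) (hxy : TreeLE T r x y)
    (hyz : TreeLE T r y z) : TreeLE T r x z := by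
  classical
  obtain ⟨p, hp, hx⟩ := hxy
  obtain ⟨q, hq, hy⟩ := hyz
  refine ⟨q, hq, ?_⟩
  have : p = q.takeUntil y hy :=
    eq_of_isPath hac hp (hq.takeUntil hy)
  exact q.support_takeUntil_subset_support hy (this ▸ hx)

/-- The vertices below a given vertex in the tree-order form a chain. -/
lemma TreeLE.total_of_le (hac : T.spanningCoe.IsAcyclic) (hx : TreeLE T r x z)
    (hy : TreeLE T r y z) : TreeLE T r x y ∨ TreeLE T r y x := by
  classical
  obtain ⟨p, hp, hx⟩ := hx
  obtain ⟨q, hq, hy⟩ := hy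
  obtain rfl : p = q := eq_of_isPath hac hp hq
  by_cases h : x ∈ (p.takeUntil y hy).support
  · exact .inl ⟨_, hp.takeUntil hy, h⟩
  · refine .inr ⟨_, hp.takeUntil hx, ?_⟩
    have h1 : x ∈ (p.dropUntil y hy).support := by
      have := p.take_spec hy ▸ hx
      rw [Walk.mem_support_append_iff] at this
      exact this.resolve_left h
    have h2 : (p.takeUntil y hy).append ((p.dropUntil y hy).takeUntil x h1) =
        p.takeUntil x hx := by
      have hpath : ((p.takeUntil y hy).append
          ((p.dropUntil y hy).takeUntil x h1)).IsPath := by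
        have : ((p.takeUntil y hy).append ((p.dropUntil y hy).takeUntil x h1)).append
            ((p.dropUntil y hy).dropUntil x h1) = p := by
          rw [← Walk.append_assoc, Walk.take_spec, Walk.take_spec]
        exact Walk.IsPath.of_append_left (this.symm ▸ hp)
      exact eq_of_isPath hac hpath (hp.takeUntil hx)
    rw [← h2, Walk.mem_support_append_iff]
    exact .inl (Walk.end_mem_support _)

lemma TreeLE.concat (hr : r ∈ T.verts) (h : G.Adj x c) (hc : c ∉ T.verts)
    (hyx : TreeLE T r y x) : TreeLE (T ⊔ G.subgraphOfAdj h) r y c := by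
  obtain ⟨p, hp, hy⟩ := hyx
  have hle : T.spanningCoe ≤ (T ⊔ G.subgraphOfAdj h).spanningCoe :=
    Subgraph.spanningCoe_le_of_le le_sup_left
  have hadj : (T ⊔ G.subgraphOfAdj h).spanningCoe.Adj x c := .inr (by simp)
  refine ⟨(p.mapLe hle).concat hadj, Walk.IsPath.concat (Walk.isPath_mapLe _ |>.2 hp) ?_ hadj, ?_⟩
  · rw [Walk.support_mapLe_eq_support]
    exact fun hcp => hc (mem_verts_of_mem_support_spanningCoe p hr c hcp)
  · rw [Walk.support_concat, Walk.support_mapLe_eq_support]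
    simp [hy]

lemma coe_isTree_sup_subgraphOfAdj (hT : T.coe.IsTree) (hx : x ∈ T.verts) (h : G.Adj x c)
    (hc : c ∉ T.verts) : (T ⊔ G.subgraphOfAdj h).coe.IsTree := by
  constructor
  · exact (Subgraph.connected_sup ⟨hT.1.preconnected⟩ (Subgraph.subgraphOfAdj_connected h).preconnected
      ⟨x, hx, by simp⟩).coe
  · rw [coe_isAcyclic_iff, Subgraph.sup_spanningCoe, Subgraph.spanningCoe_subgraphOfAdj]
    refine IsAcyclic.sup_edge_of_not_reachable ?_ (coe_isAcyclic_iff.1 hT.2)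
    rintro ⟨p⟩
    exact hc (mem_verts_of_mem_support_spanningCoe p hx c p.end_mem_support)

end Trees

/-! ### Monotonicity of ranks and Jung's theorem -/

section Rank

variable {V : Type u} {G : SimpleGraph V} {T T' : G.Subgraph} {r x y z c v : V}

/-- The same separators `X` serve for `J`; if no smaller `J`-rank exists, they witness `J`-rank
exactly `α`. -/
lemma HasIdealRank.exists_le_of_subset {I J : Set (Set V)} (hIJ : I ⊆ J) (α : Ordinal.{v}) :
    ∀ H : G.Subgraph, HasIdealRank I α H → ∃ β ≤ α, HasIdealRank J β H := by
  induction α using WellFoundedLT.induction with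
  | ind α ih =>
    intro H hH
    by_cases hsmall : ∃ β < α, HasIdealRank J β H
    · obtain ⟨β, hβ, h⟩ := hsmall
      exact ⟨β, hβ.le, h⟩
    push Not at hsmall
    refine ⟨α, le_rfl, ?_⟩
    rw [HasIdealRank] at hH ⊢
    rcases hH with ⟨h0, hI⟩ | ⟨hpos, -, X, hX, hXH, hC⟩
    · exact .inl ⟨h0, hIJ hI⟩
    · refine .inr ⟨hpos, hsmall, X, hIJ hX, hXH, fun C hCc => ?_⟩
      obtain ⟨β, hβ, h⟩ := hC C hCc
      obtain ⟨γ, hγ, h'⟩ := ih β hβ C h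
      exact ⟨γ, hγ.trans_lt hβ, h'⟩

lemma isNormalTree_singletonSubgraph (G : SimpleGraph V) (r : V) :
    IsNormalTree (G.singletonSubgraph r) r where
  root_mem := rfl
  isTree := IsTree.coe_singletonSubgraph G r
  comparable := by
    rintro x rfl y rfl - - -
    exact .inl (.refl (IsTree.coe_singletonSubgraph G _).1 rfl rfl)

/-- In a normal tree, the endvertices of a walk that avoids the tree except at its endvertices
are comparable. -/
lemma IsNormalTree.comparable_of_walk (hT : IsNormalTree T r) (hx : x ∈ T.verts)
    (hy : y ∈ T.verts) (w : G.Walk x y) (hw : ∀ z ∈ w.support, z ∈ T.verts → z = x ∨ z = y) :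
    TreeLE T r x y ∨ TreeLE T r y x := by
  classical
  exact hT.comparable x hx y hy w.bypass w.bypass_isPath
    fun z hz => hw z (w.support_bypass_subset_support hz)

/-- A normal tree remains normal if a neighbour `c` of `x` is attached to `x`, where `x` is an
upper bound of the neighbourhood of the component outside the tree that contains `c`. -/
lemma IsNormalTree.sup_subgraphOfAdj (hT : IsNormalTree T r) (hx : x ∈ T.verts) (h : G.Adj x c)
    (hc : c ∉ T.verts) (hle : ∀ y ∈ T.verts, ∀ w : G.Walk c y,
      (∀ z ∈ w.support, z ∈ T.verts → z = y) → TreeLE T r y x) :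
    IsNormalTree (T ⊔ G.subgraphOfAdj h) r := by
  have htree := coe_isTree_sup_subgraphOfAdj hT.isTree hx h hc
  have hmem : ∀ z, z ∈ (T ⊔ G.subgraphOfAdj h).verts → z ∈ T.verts ∨ z = c := by
    intro z hz
    rcases hz with hz | rfl | rfl
    · exact .inl hz
    · exact .inl hx
    · exact .inr rfl
  have hmono : ∀ z ∈ T.verts, z ∈ (T ⊔ G.subgraphOfAdj h).verts := fun z hz => .inl hz
  have hc' : c ∈ (T ⊔ G.subgraphOfAdj h).verts := .inr (.inr rfl)
  have key : ∀ y ∈ T.verts, ∀ w : G.Walk c y,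
      (∀ z ∈ w.support, z ∈ (T ⊔ G.subgraphOfAdj h).verts → z = c ∨ z = y) →
      TreeLE (T ⊔ G.subgraphOfAdj h) r y c := by
    intro y hy w hw
    refine .concat hT.root_mem h hc (hle y hy w fun z hz hzT => ?_)
    refine (hw z hz (hmono z hzT)).resolve_left ?_
    rintro rfl
    exact hc hzT
  refine ⟨hmono _ hT.root_mem, htree, fun a ha b hb p hp hpT => ?_⟩
  rcases hmem a ha with ha' | rfl
  · rcases hmem b hb with hb' | rfl
    · exact (hT.comparable a ha' b hb' p hp fun z hz hzT => hpT z hz (hmono z hzT)).imp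
        (.mono le_sup_left) (.mono le_sup_left)
    · refine .inl (key a ha' p.reverse fun z hz hzT => ?_)
      rw [Walk.support_reverse, List.mem_reverse] at hz
      exact (hpT z hz hzT).symm
  · rcases hmem b hb with hb' | rfl
    · exact .inr (key b hb' p hpT)
    · exact .inl (.refl htree.1 (hmono _ hT.root_mem) ha)

/-- The path is added edge by edge. The last hypothesis survives each step: the only new attachment
vertex is `c`, and `c` lies above `x`. -/
lemma IsNormalTree.exists_extension_along {r v x : V} (p : G.Walk x v) (hp : p.IsPath) :
    ∀ T : G.Subgraph, IsNormalTree T r → T.verts.Finite → x ∈ T.verts →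
      (∀ z ∈ p.support, z ∈ T.verts → z = x) →
      (∀ y ∈ T.verts, ∀ w : G.Walk v y, (∀ z ∈ w.support, z ∈ T.verts → z = y) →
        TreeLE T r y x) →
      ∃ T', T ≤ T' ∧ IsNormalTree T' r ∧ T'.verts.Finite ∧ v ∈ T'.verts := by
  induction p with
  | nil => exact fun T hT hfin hx _ _ => ⟨T, le_rfl, hT, hfin, hx⟩
  | @cons x c v h p ih =>
    intro T hT hfin hx hpT hle
    rw [Walk.cons_isPath_iff] at hp
    have hpT' : ∀ z ∈ p.support, z ∉ T.verts := by
      intro z hz hzT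
      exact hp.2 (hpT z (List.mem_cons_of_mem _ hz) hzT ▸ hz)
    have hc : c ∉ T.verts := hpT' c p.start_mem_support
    have hT' : IsNormalTree (T ⊔ G.subgraphOfAdj h) r := by
      refine hT.sup_subgraphOfAdj hx h hc fun y hy w hw => ?_
      refine hle y hy (p.reverse.append w) fun z hz hzT => ?_
      rw [Walk.mem_support_append_iff, Walk.support_reverse, List.mem_reverse] at hz
      exact hw z (hz.resolve_left fun hz => hpT' z hz hzT) hzT
    have hc' : c ∈ (T ⊔ G.subgraphOfAdj h).verts := .inr (.inr rfl)
    have h1 : ∀ z ∈ p.support, z ∈ (T ⊔ G.subgraphOfAdj h).verts → z = c := by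
      rintro z hz (hzT | hzT | hzT)
      exacts [absurd hzT (hpT' z hz), absurd (hzT ▸ hz) hp.2, hzT]
    have h2 : ∀ y ∈ (T ⊔ G.subgraphOfAdj h).verts, ∀ w : G.Walk v y,
        (∀ z ∈ w.support, z ∈ (T ⊔ G.subgraphOfAdj h).verts → z = y) →
        TreeLE (T ⊔ G.subgraphOfAdj h) r y c := by
      intro y hy w hw
      by_cases hyc : y = c
      · rw [hyc]
        exact .refl hT'.isTree.1 hT'.root_mem hc'
      · have hyT : y ∈ T.verts := by
          rcases hy with hy | hy | hy
          exacts [hy, hy ▸ hx, absurd hy hyc]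
        exact .concat hT.root_mem h hc (hle y hyT w fun z hz hzT => hw z hz (.inl hzT))
    obtain ⟨T'', hle', hT''⟩ :=
      ih hp.1 (T ⊔ G.subgraphOfAdj h) hT' (hfin.union (by simp)) hc' h1 h2
    exact ⟨T'', le_sup_left.trans hle', hT''⟩

lemma exists_walk_first_mem {S : Set V} (w : G.Walk x y) (hy : y ∈ S) :
    ∃ a ∈ S, ∃ q : G.Walk x a, ∀ z ∈ q.support, z ∈ S → z = a := by
  induction w with
  | nil => exact ⟨_, hy, .nil, by simp⟩
  | @cons x b y h w ih =>
    by_cases hx : x ∈ S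
    · exact ⟨x, hx, .nil, by simp⟩
    · obtain ⟨a, ha, q, hq⟩ := ih hy
      refine ⟨a, ha, .cons h q, fun z hz hzS => ?_⟩
      rw [Walk.support_cons, List.mem_cons] at hz
      rcases hz with rfl | hz
      exacts [absurd hzS hx, hq z hz hzS]

/-- A finite normal tree in a connected graph extends to a finite normal tree that contains a
given vertex. -/
lemma IsNormalTree.exists_extension (hG : G.Connected) (hT : IsNormalTree T r)
    (hfin : T.verts.Finite) (v : V) :
    ∃ T', T ≤ T' ∧ IsNormalTree T' r ∧ T'.verts.Finite ∧ v ∈ T'.verts := by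
  classical
  -- The neighbourhood in `T` of the component of `v` outside `T`; it is `{v}` if `v` is already in
  -- `T`.
  let N : Set V := {y | y ∈ T.verts ∧ ∃ w : G.Walk v y, ∀ z ∈ w.support, z ∈ T.verts → z = y}
  obtain ⟨w⟩ := hG.preconnected v r
  obtain ⟨a, ha, q, hq⟩ := exists_walk_first_mem w hT.root_mem
  have haN : a ∈ N := ⟨ha, q, hq⟩
  -- Two members of `N` are joined through `v` by a walk avoiding `T` except at its ends, so
  -- normality makes them comparable.
  have hdir : Directed (TreeLE T r) (Subtype.val : N → V) := by
    rintro ⟨y, hy, w, hw⟩ ⟨y', hy', w', hw'⟩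
    have := hT.comparable_of_walk hy hy' (w.reverse.append w') fun z hz hzT => by
      rw [Walk.mem_support_append_iff, Walk.support_reverse, List.mem_reverse] at hz
      exact hz.imp (fun h => hw z h hzT) fun h => hw' z h hzT
    rcases this with h | h
    · exact ⟨⟨y', hy', w', hw'⟩, h, .refl hT.isTree.1 hT.root_mem hy'⟩
    · exact ⟨⟨y, hy, w, hw⟩, .refl hT.isTree.1 hT.root_mem hy, h⟩
  have : Nonempty N := ⟨⟨a, haN⟩⟩
  have : IsTrans V (TreeLE T r) := ⟨fun _ _ _ => .trans (coe_isAcyclic_iff.1 hT.isTree.2)⟩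
  have hNfin : N.Finite := hfin.subset fun y hy => hy.1
  have : Finite N := hNfin
  obtain ⟨⟨m, hm, w, hw⟩, hmax⟩ := hdir.finite_set_le (s := Set.univ) Set.finite_univ
  refine exists_extension_along w.reverse.bypass (Walk.bypass_isPath _) T hT hfin hm ?_ ?_
  · intro z hz hzT
    refine hw z ?_ hzT
    simpa using w.reverse.support_bypass_subset_support hz
  · exact fun y hy w hw => hmax ⟨y, hy, w, hw⟩ trivial

/-- The union of an increasing sequence of normal trees with the same root is a normal tree. -/
lemma isNormalTree_iSup {T : ℕ → G.Subgraph} (hmono : Monotone T)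
    (hT : ∀ n, IsNormalTree (T n) r) : IsNormalTree (⨆ n, T n) r := by
  have hle : ∀ n, T n ≤ ⨆ n, T n := le_iSup T
  have hmem : ∀ {x}, x ∈ (⨆ n, T n).verts ↔ ∃ n, x ∈ (T n).verts := by simp
  have hroot : r ∈ (⨆ n, T n).verts := hmem.2 ⟨0, (hT 0).root_mem⟩
  refine ⟨hroot, coe_isTree_of_reachable hroot ?_ ?_, ?_⟩
  · have : (⨆ n, T n).spanningCoe = sSup (Set.range fun n => (T n).spanningCoe) := by
      ext a b
      simp [sSup_range]
    rw [this]
    refine isAcyclic_sSup_of_isAcyclic_directedOn _ ?_ ?_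
    · rintro _ ⟨n, rfl⟩
      exact coe_isAcyclic_iff.1 (hT n).isTree.2
    · rw [directedOn_range]
      exact Monotone.directed_le fun m n hmn => Subgraph.spanningCoe_le_of_le (hmono hmn)
  · intro x hx
    obtain ⟨n, hn⟩ := hmem.1 hx
    exact (reachable_spanningCoe (hT n).isTree.1 (hT n).root_mem hn).mono
      (Subgraph.spanningCoe_le_of_le (hle n))
  · intro x hx y hy p hp hpT
    obtain ⟨m, hm⟩ := hmem.1 hx
    obtain ⟨n, hn⟩ := hmem.1 hy
    exact ((hT (max m n)).comparable x ((hmono (le_max_left m n)).1 hm) y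
      ((hmono (le_max_right m n)).1 hn) p hp fun z hz hzT => hpT z hz ((hle _).1 hzT)).imp
        (.mono (hle _)) (.mono (hle _))

/-- Jung's theorem: countable sets of vertices of a connected graph are normally spanned. -/
theorem normallySpanned_of_countable (hG : G.Connected) {U : Set V} (hU : U.Countable) :
    NormallySpanned G U := by
  obtain ⟨r⟩ := hG.nonempty
  obtain ⟨e, he⟩ : ∃ e : ℕ → V, U ⊆ Set.range e := by
    have : Nonempty V := ⟨r⟩
    exact Set.countable_iff_exists_subset_range.1 hU
  let S := {T : G.Subgraph // IsNormalTree T r ∧ T.verts.Finite}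
  choose next hnext using fun (T : S) (v : V) => T.2.1.exists_extension hG T.2.2 v
  let T : ℕ → S := Nat.rec ⟨G.singletonSubgraph r, isNormalTree_singletonSubgraph G r, by simp⟩
    fun n T => ⟨next T (e n), (hnext T (e n)).2.1, (hnext T (e n)).2.2.1⟩
  have hT : ∀ n, (T n).1 ≤ (T (n + 1)).1 ∧ e n ∈ (T (n + 1)).1.verts := fun n =>
    ⟨(hnext (T n) (e n)).1, (hnext (T n) (e n)).2.2.2⟩
  refine ⟨⨆ n, (T n).1, r, isNormalTree_iSup (monotone_nat_of_le_succ fun n => (hT n).1)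
    fun n => (T n).2.1, fun x hx => ?_⟩
  obtain ⟨n, rfl⟩ := he hx
  exact (le_iSup (fun n => (T n).1) (n + 1)).1 (hT n).2

theorem exists_hasNormalRank_le (hG : G.Connected) {α : Ordinal.{v}}
    (h : HasCardRank G (Cardinal.aleph 1) α) : ∃ β ≤ α, HasNormalRank G β :=
  HasIdealRank.exists_le_of_subset
    (fun _ hX => normallySpanned_of_countable hG (Cardinal.le_aleph0_iff_set_countable.1 (Cardinal.lt_aleph_one_iff.1 hX))) α _ h

end Rank

/-! ### Components and ranks at most 1 -/

section Components

variable {V : Type u} {G : SimpleGraph V}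

/-- The union of all connected subgraphs of `H` through a fixed vertex of `K` is connected. -/
lemma exists_isComponent_ge {K H : G.Subgraph} (hKH : K ≤ H) (hK : K.Connected) :
    ∃ C, IsComponent C H ∧ K ≤ C := by
  obtain ⟨x, hx⟩ := hK.nonempty
  let F : Set G.Subgraph := {L | L ≤ H ∧ L.Connected ∧ x ∈ L.verts}
  have hle : ∀ L ∈ F, L ≤ sSup F := fun L hL => le_sSup hL
  refine ⟨sSup F, ⟨⟨sSup_le fun L hL => hL.1, ?_⟩, fun D hD hCD => hle D ⟨hD.1, hD.2, ?_⟩⟩,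
    hle K ⟨hKH, hK, hx⟩⟩
  · rw [Subgraph.connected_iff_forall_exists_walk_subgraph]
    refine ⟨⟨x, (hle K ⟨hKH, hK, hx⟩).1 hx⟩, fun {a b} ha hb => ?_⟩
    rw [Subgraph.verts_sSup, Set.mem_iUnion₂] at ha hb
    obtain ⟨L, hL, ha⟩ := ha
    obtain ⟨M, hM, hb⟩ := hb
    obtain ⟨p, hp⟩ := (Subgraph.connected_iff_forall_exists_walk_subgraph L).1 hL.2.1 |>.2 ha hL.2.2
    obtain ⟨q, hq⟩ := (Subgraph.connected_iff_forall_exists_walk_subgraph M).1 hM.2.1 |>.2 hM.2.2 hb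
    refine ⟨p.append q, ?_⟩
    rw [Walk.toSubgraph_append]
    exact sup_le (hp.trans (hle L hL)) (hq.trans (hle M hM))
  · exact hCD.1 ((hle K ⟨hKH, hK, hx⟩).1 hx)

lemma exists_hasIdealRank {I : Set (Set V)} {H : G.Subgraph} {X : Set V} (hX : X ∈ I)
    (hXH : X ⊆ H.verts) (hC : ∀ C, IsComponent C (H.deleteVerts X) → C.verts ∈ I) :
    ∃ α : Ordinal.{v}, HasIdealRank I α H := by
  have hzero : ∀ C : G.Subgraph, HasIdealRank I (0 : Ordinal.{v}) C ↔ C.verts ∈ I := by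
    intro C
    rw [HasIdealRank]
    simp
  by_cases h : HasIdealRank I (0 : Ordinal.{v}) H
  · exact ⟨0, h⟩
  · refine ⟨1, ?_⟩
    rw [HasIdealRank]
    refine .inr ⟨zero_lt_one, fun β hβ => ?_, X, hX, hXH, fun C hCc =>
      ⟨0, zero_lt_one, (hzero C).2 (hC C hCc)⟩⟩
    obtain rfl := Order.lt_one_iff.1 hβ
    exact h

end Components

/-! ### Least elements in normal spanning trees -/

section Spanning

variable {V : Type u} {G : SimpleGraph V} {T : G.Subgraph} {r x y : V}

lemma TreeLE.dist_lt (hac : T.spanningCoe.IsAcyclic) (h : TreeLE T r x y) (hxy : x ≠ y) :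
    T.spanningCoe.dist r x < T.spanningCoe.dist r y := by
  classical
  obtain ⟨p, hp, hx⟩ := h
  obtain ⟨q, hq, hlen⟩ := p.reachable.exists_path_of_dist
  obtain rfl := eq_of_isPath hac hp hq
  rw [← hlen]
  exact (SimpleGraph.dist_le _).trans_lt (p.length_takeUntil_lt_length hx hxy)

/-- A connected set of vertices has a least element in the tree-order of a normal spanning tree. -/
lemma IsNormalTree.exists_least (hT : IsNormalTree T r) (hspan : T.IsSpanning) {S : Set V}
    (hx : x ∈ S) (hS : ∀ z ∈ S, ∃ w : G.Walk x z, ∀ y ∈ w.support, y ∈ S) :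
    ∃ m ∈ S, ∀ z ∈ S, TreeLE T r m z := by
  have hac := coe_isAcyclic_iff.1 hT.isTree.2
  obtain ⟨m, hm, hmin⟩ := WellFounded.has_min
    (InvImage.wf (fun z => T.spanningCoe.dist r z) Nat.lt_wfRel.wf) S ⟨x, hx⟩
  -- Being above `m` propagates along edges `ab` in `S`: if `b` lies below `a`, then `b` and `m` are
  -- comparable, and `b` strictly below `m` would be closer to the root.
  have key : ∀ a z (w : G.Walk a z), (∀ y ∈ w.support, y ∈ S) → TreeLE T r m a →
      TreeLE T r m z := by
    intro a z w
    induction w with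
    | nil => exact fun _ h => h
    | @cons a b z h w ih =>
      intro hw hma
      refine ih (fun y hy => hw y (List.mem_cons_of_mem _ hy)) ?_
      rcases hT.comparable a (hspan a) b (hspan b) h.toWalk h.isPath_toWalk
        (fun z hz _ => by simpa using hz) with hab | hba
      · exact hma.trans hac hab
      · rcases hma.total_of_le hac hba with hmb | hbm
        · exact hmb
        · by_cases hne : b = m
          · exact hne ▸ .refl hT.isTree.1 hT.root_mem (hspan b)
          · exact absurd (hbm.dist_lt hac hne)
              (hmin b (hw b (List.mem_cons_of_mem _ w.start_mem_support)))
  refine ⟨m, hm, fun z hz => ?_⟩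
  obtain ⟨p, hp⟩ := hS m hm
  obtain ⟨q, hq⟩ := hS z hz
  refine key m z (p.reverse.append q) (fun y hy => ?_)
    (.refl hT.isTree.1 hT.root_mem (hspan m))
  rw [Walk.mem_support_append_iff, Walk.support_reverse, List.mem_reverse] at hy
  exact hy.elim (hp y) (hq y)

end Spanning

/-! ### Trees with all tops -/

section Tops

variable {ι : Type u} {N : (ℕ → ι) → Set ℕ} {s t : List ι} {f : ℕ → ι} {i j : ι}

lemma treeWithAllTops_adj_inl_inl :
    (treeWithAllTops N).Adj (.inl s) (.inl t) ↔ (∃ i, t = s ++ [i]) ∨ ∃ i, s = t ++ [i] := by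
  simp only [treeWithAllTops, fromRel_adj, topsRel, and_iff_right_iff_imp]
  rintro (⟨i, rfl⟩ | ⟨i, rfl⟩) <;> simp

lemma treeWithAllTops_adj_inr_inl :
    (treeWithAllTops N).Adj (.inr f) (.inl s) ↔ ∃ n ∈ N f, s = rayVertex f n := by
  simp [treeWithAllTops, fromRel_adj, topsRel]

lemma not_treeWithAllTops_adj_inr_inr {f g : ℕ → ι} :
    ¬ (treeWithAllTops N).Adj (.inr f) (.inr g) := by
  simp [treeWithAllTops, fromRel_adj, topsRel]

lemma rayVertex_succ (f : ℕ → ι) (n : ℕ) : rayVertex f (n + 1) = rayVertex f n ++ [f n] := by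
  simp [rayVertex, List.range_succ]

lemma rayVertex_prefix (f : ℕ → ι) {m n : ℕ} (h : m ≤ n) : rayVertex f m <+: rayVertex f n := by
  induction n, h using Nat.le_induction with
  | base => exact List.prefix_rfl
  | succ n _ ih => exact ih.trans (rayVertex_succ f n ▸ List.prefix_append _ _)

/-- The cone above `s`: all nodes of the tree above `s` together with the tops of all the rays
through `s`. -/
def cone (s : List ι) : Set (List ι ⊕ (ℕ → ι)) :=
  {z | Sum.elim (fun t => s <+: t) (fun f => ∃ n, s <+: rayVertex f n) z}

@[simp] lemma inl_mem_cone : Sum.inl t ∈ cone s ↔ s <+: t := Iff.rfl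

@[simp] lemma inr_mem_cone : Sum.inr f ∈ cone s ↔ ∃ n, s <+: rayVertex f n := Iff.rfl

lemma cone_anti (h : s <+: t) : cone t ⊆ cone s := by
  rintro (l | f) hz
  · exact h.trans hz
  · obtain ⟨n, hn⟩ := hz
    exact ⟨n, h.trans hn⟩

lemma eq_of_mem_cone {z : List ι ⊕ (ℕ → ι)} (hi : z ∈ cone (s ++ [i])) (hj : z ∈ cone (s ++ [j])) :
    i = j := by
  have key : ∀ l : List ι, s ++ [i] <+: l → s ++ [j] <+: l → i = j := by
    intro l h h'
    have := (List.prefix_of_prefix_length_le h h' (by simp)).eq_of_length (by simp)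
    simpa using this
  rcases z with l | f
  · exact key l hi hj
  · obtain ⟨n, hn⟩ := hi
    obtain ⟨m, hm⟩ := hj
    exact key _ (hn.trans (rayVertex_prefix f (le_max_left n m)))
      (hm.trans (rayVertex_prefix f (le_max_right n m)))

/-- Nodes are reached by climbing the tree; a top is reached through a neighbour above `s`, which
exists because `N f` is unbounded. -/
lemma exists_walk_in_cone (hN : ∀ f, (N f).Infinite) (s : List ι) :
    ∀ z ∈ cone s, ∃ w : (treeWithAllTops N).Walk (.inl s) z, ∀ y ∈ w.support, y ∈ cone s := by
  have key : ∀ l : List ι, ∃ w : (treeWithAllTops N).Walk (.inl s) (.inl (s ++ l)),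
      ∀ y ∈ w.support, y ∈ cone s := by
    intro l
    induction l using List.reverseRecOn with
    | nil => exact ⟨Walk.nil.copy rfl (by simp), by simp⟩
    | append_singleton l i ih =>
      obtain ⟨w, hw⟩ := ih
      have h : (treeWithAllTops N).Adj (.inl (s ++ l)) (.inl (s ++ (l ++ [i]))) :=
        treeWithAllTops_adj_inl_inl.2 (.inl ⟨i, by simp⟩)
      refine ⟨w.concat h, fun y hy => ?_⟩
      rw [Walk.support_concat, List.mem_append, List.mem_singleton] at hy
      rcases hy with hy | rfl
      · exact hw y hy
      · simp
  rintro (t | f) hz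
  · obtain ⟨l, rfl⟩ := hz
    exact key l
  · obtain ⟨n, hn⟩ := hz
    obtain ⟨m, hm, hnm⟩ := (hN f).exists_gt n
    obtain ⟨l, hl⟩ := hn.trans (rayVertex_prefix f hnm.le)
    obtain ⟨w, hw⟩ := key l
    have h : (treeWithAllTops N).Adj (.inl (s ++ l)) (.inr f) :=
      (treeWithAllTops_adj_inr_inl.2 ⟨m, hm, hl⟩).symm
    refine ⟨w.concat h, fun y hy => ?_⟩
    rw [Walk.support_concat, List.mem_append, List.mem_singleton] at hy
    rcases hy with hy | rfl
    · exact hw y hy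
    · exact ⟨n, hn⟩

lemma treeWithAllTops_connected (hN : ∀ f, (N f).Infinite) : (treeWithAllTops N).Connected := by
  rw [connected_iff_exists_forall_reachable]
  refine ⟨.inl [], fun z => ?_⟩
  have hz : z ∈ cone [] := by
    rcases z with t | f
    · simp
    · exact ⟨0, List.nil_prefix⟩
  obtain ⟨w, -⟩ := exists_walk_in_cone hN [] z hz
  exact ⟨w⟩

lemma induce_cone_connected (hN : ∀ f, (N f).Infinite) (s : List ι) :
    ((⊤ : (treeWithAllTops N).Subgraph).induce (cone s)).Connected := by
  rw [← connected_induce_iff, connected_iff_exists_forall_reachable]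
  refine ⟨⟨.inl s, List.prefix_rfl⟩, fun ⟨z, hz⟩ => ?_⟩
  obtain ⟨w, hw⟩ := exists_walk_in_cone hN s z hz
  exact ⟨w.induce _ hw⟩

/-- No subgraph that contains a cone has an `ℵ₁`-rank. -/
lemma not_hasIdealRank_of_cone_le [Uncountable ι] (hN : ∀ f, (N f).Infinite)
    {I : Set (Set (List ι ⊕ (ℕ → ι)))} (hI : ∀ X ∈ I, X.Countable) (α : Ordinal.{v}) :
    ∀ (s : List ι) (H : (treeWithAllTops N).Subgraph),
      (⊤ : (treeWithAllTops N).Subgraph).induce (cone s) ≤ H → ¬ HasIdealRank I α H := by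
  induction α using WellFoundedLT.induction with
  | ind α ih =>
    intro s H hH hrank
    -- Otherwise a point of `X` in each of these disjoint cones would inject `ι` into the countable
    -- set `X`.
    have hfree : ∀ X ∈ I, ∃ i, ∀ z ∈ cone (s ++ [i]), z ∉ X := by
      intro X hX
      by_contra! hcon
      choose z hz hzX using hcon
      have hinj : Function.Injective fun i => (⟨z i, hzX i⟩ : X) := fun i j hij => by
        have hij : z i = z j := congrArg Subtype.val hij
        exact eq_of_mem_cone (hz i) (hij ▸ hz j)
      have : Countable X := hI X hX
      exact not_countable_iff.2 ‹Uncountable ι› hinj.countable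
    rw [HasIdealRank] at hrank
    rcases hrank with ⟨-, h0⟩ | ⟨-, -, X, hX, -, hC⟩
    · obtain ⟨i, hi⟩ := hfree _ h0
      exact hi (.inl (s ++ [i])) List.prefix_rfl (hH.1 (List.prefix_append _ _))
    · obtain ⟨i, hi⟩ := hfree X hX
      have hle : (⊤ : (treeWithAllTops N).Subgraph).induce (cone (s ++ [i])) ≤
          H.deleteVerts X := by
        have hsub : cone (s ++ [i]) ⊆ cone s := cone_anti (List.prefix_append _ _)
        refine ⟨fun z hz => ⟨hH.1 (hsub hz), hi z hz⟩, fun a b hab => ?_⟩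
        obtain ⟨ha, hb, hab⟩ := hab
        rw [Subgraph.deleteVerts_adj]
        exact ⟨hH.1 (hsub ha), hi a ha, hH.1 (hsub hb), hi b hb, hH.2 ⟨hsub ha, hsub hb, hab⟩⟩
      obtain ⟨C, hCc, hle⟩ := exists_isComponent_ge hle (induce_cone_connected hN _)
      obtain ⟨β, hβ, h⟩ := hC C hCc
      exact ih β hβ _ C hle h

lemma not_hasNormalSpanningTree_treeWithAllTops [Nontrivial ι] (hN : ∀ f, (N f).Infinite) :
    ¬ HasNormalSpanningTree (treeWithAllTops N) := by
  rintro ⟨T, r, hT, hspan⟩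
  choose m hm hmle using fun s : List ι =>
    hT.exists_least hspan (S := cone s) (x := .inl s) List.prefix_rfl (exists_walk_in_cone hN s)
  -- The cones of distinct children are disjoint, so `m s` lies in at most one of them.
  have hchild : ∀ s : List ι, ∃ i, m s ∉ cone (s ++ [i]) := by
    intro s
    by_contra! hcon
    obtain ⟨i, j, hij⟩ := exists_pair_ne ι
    exact hij (eq_of_mem_cone (hcon i) (hcon j))
  choose c hc using hchild
  let S : ℕ → List ι := Nat.rec [] fun _ s => s ++ [c s]
  have hray : ∀ n, rayVertex (fun n => c (S n)) n = S n := by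
    intro n
    induction n with
    | zero => rfl
    | succ n ih => rw [rayVertex_succ, ih]
  set f : ℕ → ι := fun n => c (S n)
  have hlt : ∀ n k, n < k → m (S n) ≠ m (S k) := by
    intro n k hnk heq
    refine hc (S n) (heq ▸ cone_anti ?_ (hm (S k)))
    have := rayVertex_prefix f (Nat.succ_le_of_lt hnk)
    rwa [hray, hray] at this
  have hinj : Function.Injective fun n => m (S n) := by
    intro n k hnk
    rcases lt_trichotomy n k with h | h | h
    exacts [absurd hnk (hlt n k h), h, absurd hnk.symm (hlt k n h)]
  have hle : ∀ n, TreeLE T r (m (S n)) (.inr f) := fun n =>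
    hmle (S n) _ ⟨n, by rw [hray]⟩
  -- The unique tree path `p` from the root to the top `f` must contain all the distinct vertices `m
  -- (S n)`.
  obtain ⟨p, hp, -⟩ := hle 0
  refine Set.infinite_range_of_injective hinj (p.support.finite_toSet.subset ?_)
  rintro _ ⟨n, rfl⟩
  obtain ⟨q, hq, h⟩ := hle n
  obtain rfl := eq_of_isPath (coe_isAcyclic_iff.1 hT.isTree.2) hp hq
  exact h

/-- The tree of finite sequences, as a subgraph of the tree with all tops. -/
def treeOfNodes (N : (ℕ → ι) → Set ℕ) : (treeWithAllTops N).Subgraph :=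
  (⊤ : (treeWithAllTops N).Subgraph).induce (Set.range Sum.inl)

lemma treeOfNodes_adj_concat (s : List ι) (i : ι) :
    (treeOfNodes N).spanningCoe.Adj (.inl s) (.inl (s ++ [i])) :=
  ⟨⟨_, rfl⟩, ⟨_, rfl⟩, treeWithAllTops_adj_inl_inl.2 (.inl ⟨i, rfl⟩)⟩

lemma exists_path_treeOfNodes (t : List ι) :
    ∃ p : (treeOfNodes N).spanningCoe.Walk (.inl []) (.inl t), p.IsPath ∧
      ∀ s, Sum.inl s ∈ p.support ↔ s <+: t := by
  induction t using List.reverseRecOn with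
  | nil => exact ⟨.nil, by simp, by simp⟩
  | append_singleton t i ih =>
    obtain ⟨p, hp, hs⟩ := ih
    refine ⟨p.concat (treeOfNodes_adj_concat t i), hp.concat ?_ _, fun s => ?_⟩
    · rw [hs]
      exact fun h => by simpa using h.length_le
    · rw [Walk.support_concat, List.mem_append, List.mem_singleton, hs, List.prefix_concat_iff, Sum.inl.injEq, or_comm]

lemma treeLE_treeOfNodes (h : s <+: t) : TreeLE (treeOfNodes N) (.inl []) (.inl s) (.inl t) := by
  obtain ⟨p, hp, hs⟩ := exists_path_treeOfNodes (N := N) t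
  exact ⟨p, hp, (hs s).2 h⟩

/-- Every edge is a bridge: the one from `s` to `s ++ [i]` is the only tree edge entering the cone
of `s ++ [i]`. -/
lemma treeOfNodes_isAcyclic (N : (ℕ → ι) → Set ℕ) : (treeOfNodes N).spanningCoe.IsAcyclic := by
  have key : ∀ (s : List ι) (i : ι),
      (treeOfNodes N).spanningCoe.IsBridge s(.inl s, .inl (s ++ [i])) := by
    intro s i
    rw [isBridge_iff]
    rintro ⟨w⟩
    obtain ⟨d, -, hd1, hd2⟩ := w.exists_boundary_dart (cone (s ++ [i]))ᶜ
      (fun h => by simpa using (inl_mem_cone.1 h).length_le) (by simp)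
    rcases d with ⟨⟨a, b⟩, hd⟩
    rw [deleteEdges_adj] at hd
    obtain ⟨⟨⟨a, rfl⟩, ⟨b, rfl⟩, hab⟩, hne⟩ := hd
    simp only [Set.mem_compl_iff, inl_mem_cone, not_not] at hd1 hd2
    rcases treeWithAllTops_adj_inl_inl.1 hab with ⟨j, rfl⟩ | ⟨j, rfl⟩
    · rcases List.prefix_concat_iff.1 hd2 with h | h
      · obtain ⟨rfl, h⟩ := List.append_inj' h rfl
        obtain rfl : i = j := by simpa using h
        exact hne rfl
      · exact hd1 h
    · exact hd1 (hd2.trans (List.prefix_append _ _))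
  rw [isAcyclic_iff_forall_adj_isBridge]
  rintro _ _ ⟨⟨a, rfl⟩, ⟨b, rfl⟩, hab⟩
  rcases treeWithAllTops_adj_inl_inl.1 hab with ⟨j, rfl⟩ | ⟨j, rfl⟩
  · exact key a j
  · rw [Sym2.eq_swap]
    exact key b j

/-- Tops are pairwise nonadjacent, so a nontrivial path meeting the tree only in its ends is an edge
or passes through a single top, whose neighbours are prefixes of one sequence. -/
lemma isNormalTree_treeOfNodes (N : (ℕ → ι) → Set ℕ) :
    IsNormalTree (treeOfNodes N) (.inl []) := by
  have hroot : Sum.inl [] ∈ (treeOfNodes N).verts := ⟨[], rfl⟩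
  refine ⟨hroot, coe_isTree_of_reachable hroot (treeOfNodes_isAcyclic N) ?_, ?_⟩
  · rintro _ ⟨t, rfl⟩
    exact (exists_path_treeOfNodes t).choose.reachable
  · rintro _ ⟨s, rfl⟩ _ ⟨t, rfl⟩ p hp hpT
    have hmem : ∀ t : List ι, Sum.inl t ∈ (treeOfNodes N).verts := fun t => ⟨t, rfl⟩
    suffices s <+: t ∨ t <+: s from this.imp treeLE_treeOfNodes treeLE_treeOfNodes
    cases p with
    | nil => exact .inl List.prefix_rfl
    | @cons _ b _ h q =>
      rw [Walk.cons_isPath_iff] at hp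
      rcases b with b | f
      · obtain rfl : b = t := by
          rcases hpT (.inl b) (by simp) (hmem b) with h' | h'
          · exact absurd (h' ▸ q.start_mem_support) hp.2
          · simpa using h'
        rcases treeWithAllTops_adj_inl_inl.1 h with ⟨i, rfl⟩ | ⟨i, rfl⟩
        exacts [.inl (List.prefix_append _ _), .inr (List.prefix_append _ _)]
      · obtain ⟨m, -, rfl⟩ := treeWithAllTops_adj_inr_inl.1 h.symm
        cases q with
        | @cons _ b _ h' q =>
          rcases b with b | g
          · obtain rfl : b = t := by
              rcases hpT (.inl b) (by simp) (hmem b) with h'' | h''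
              · exact absurd (by simp [← h'']) hp.2
              · simpa using h''
            obtain ⟨n, -, rfl⟩ := treeWithAllTops_adj_inr_inl.1 h'
            exact (le_total m n).imp (rayVertex_prefix f) (rayVertex_prefix f)
          · exact absurd h' not_treeWithAllTops_adj_inr_inr

lemma exists_hasNormalRank_treeWithAllTops (N : (ℕ → ι) → Set ℕ) :
    ∃ α : Ordinal.{v}, HasNormalRank (treeWithAllTops N) α := by
  refine exists_hasIdealRank (X := Set.range Sum.inl)
    ⟨treeOfNodes N, .inl [], isNormalTree_treeOfNodes N, subset_rfl⟩ (Set.subset_univ _) ?_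
  rintro C ⟨⟨hCle, hC⟩, -⟩
  have hsub : C.verts.Subsingleton := by
    rw [← Set.not_nontrivial_iff]
    intro hnt
    have : Nontrivial C.verts := hnt.coe_sort
    obtain ⟨x, hx⟩ := hC.nonempty
    obtain ⟨y, hy⟩ := hC.preconnected.exists_adj_of_nontrivial ⟨x, hx⟩
    have hxy := hCle.2 hy
    rw [Subgraph.deleteVerts_adj] at hxy
    rcases x with x | f
    · exact hxy.2.1 ⟨x, rfl⟩
    · rcases y with y | g
      · exact hxy.2.2.2.1 ⟨y, rfl⟩
      · exact not_treeWithAllTops_adj_inr_inr hxy.2.2.2.2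
  obtain ⟨x, hx⟩ := hC.nonempty
  exact ⟨_, x, isNormalTree_singletonSubgraph _ x, fun y hy => hsub hy hx⟩

theorem treeWithAllTops_properties (hι : Cardinal.mk ι = Cardinal.aleph 1)
    (hN : ∀ f, (N f).Infinite) :
    (treeWithAllTops N).Connected ∧
      (∃ α : Ordinal.{v}, HasNormalRank (treeWithAllTops N) α) ∧
      (¬ ∃ α : Ordinal.{v}, HasCardRank (treeWithAllTops N) (Cardinal.aleph 1) α) ∧
      ¬ HasNormalSpanningTree (treeWithAllTops N) := by
  have : Uncountable ι := by
    rw [← Cardinal.aleph0_lt_mk_iff, hι]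
    exact Cardinal.aleph0_lt_aleph_one
  refine ⟨treeWithAllTops_connected hN, exists_hasNormalRank_treeWithAllTops N, ?_,
    not_hasNormalSpanningTree_treeWithAllTops hN⟩
  rintro ⟨α, hα⟩
  refine not_hasIdealRank_of_cone_le hN (fun X hX => ?_) α [] ⊤ le_top hα
  exact Cardinal.le_aleph0_iff_set_countable.1 (Cardinal.lt_aleph_one_iff.1 hX)

end Tops

end NormalRank

theorem lemma4p1 :
    -- every connected graph of ℵ₁-rank `α` has normal rank at most `α`
    (∀ (V : Type u) (G : SimpleGraph V), G.Connected → ∀ α : Ordinal.{v},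
      NormalRank.HasCardRank G (Cardinal.aleph 1) α →
        ∃ β : Ordinal.{v}, β ≤ α ∧ NormalRank.HasNormalRank G β) ∧
    -- there is a connected graph with a normal rank but no ℵ₁-rank and no normal spanning tree
    (∃ (V : Type u) (G : SimpleGraph V), G.Connected ∧
      (∃ α : Ordinal.{v}, NormalRank.HasNormalRank G α) ∧
      (¬ ∃ α : Ordinal.{v}, NormalRank.HasCardRank G (Cardinal.aleph 1) α) ∧
      ¬ NormalRank.HasNormalSpanningTree G) ∧
    -- for instance, every ℵ₁-branching tree with all tops is such a graph
    (∀ (ι : Type u), Cardinal.mk ι = Cardinal.aleph 1 →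
      ∀ N : (ℕ → ι) → Set ℕ, (∀ f, (N f).Infinite) →
        (NormalRank.treeWithAllTops N).Connected ∧
        (∃ α : Ordinal.{v}, NormalRank.HasNormalRank (NormalRank.treeWithAllTops N) α) ∧
        (¬ ∃ α : Ordinal.{v},
          NormalRank.HasCardRank (NormalRank.treeWithAllTops N) (Cardinal.aleph 1) α) ∧
        ¬ NormalRank.HasNormalSpanningTree (NormalRank.treeWithAllTops N)) := by
  refine ⟨fun V G hG α h => NormalRank.exists_hasNormalRank_le hG h, ?_,
    fun ι hι N hN => NormalRank.treeWithAllTops_properties hι hN⟩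
  -- The example joins each top to every vertex of its ray.
  exact ⟨_, _, NormalRank.treeWithAllTops_properties (Cardinal.mk_out _)
    (N := fun _ => Set.univ) fun _ => Set.infinite_univ⟩
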